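/- For each $n\ge1$, let $\lambda_{i}=\lambda_{n,i}\ge 1$ ($i=1,\dots,n$) be known, and let $X_1,\dots,X_n$ be independent. Under the null hypothesis $H_0$, $X_i\sim\mathrm{Pois}(\lambda_i)$; under the alternative $H_1$, $$X_i\sim(1-\varepsilon)\,\mathrm{Pois}(\lambda_i)+\varepsilon\,\mathrm{Pois}(\lambda_i+\Delta_i),$$ where $\Delta_i=\Delta_{n,i}>0$ and $\varepsilon=\varepsilon_n\in[0,1]$. Define the one-sided p-values $p_i=G_{\lambda_i}(X_i)$, where $G_\lambda(x)=\mathbb P(\Upsilon_\lambda\ge x)$ and $\Upsilon_\lambda\sim\mathrm{Pois}(\lambda)$. Fisher's test rejects $H_0$ for large values of $V_n=-2\sum_{i=1}^n\log p_i$. It is called asymptotically powerful if there are critical values $t_n\in\mathbb R$ such that the risk (the sum of the probabilities of type I and type II errors) of the test that rejects when $V_n\ge t_n$ tends to zero: $$\mathbb P_{H_0}(V_n\ge t_n)+\mathbb P_{H_1}(V_n<t_n)\to0\qquad(n\to\infty).$$ Let $a_i=\Delta_i/\sqrt{\lambda_i}$. Fisher's test is asymptotically powerful if $$\frac{\varepsilon\sum_{i=1}^n\min(a_i,1)}{\sqrt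 n}\to\infty\qquad(n\to\infty).$$ In particular, if $\varepsilon=n^{-\beta}$ with $\beta\in(0,1/2)$ fixed and $\Delta_i=n^{s}\sqrt{\lambda_i}$ with $s\in\mathbb R$ fixed, then Fisher's test is asymptotically powerful when $s>\beta-\tfrac12$. -/

import Mathlib

open MeasureTheory ProbabilityTheory Filter Topology
open scoped ENNReal

noncomputable section

/-- The Poisson law with real mean `lam` (used only for `lam ≥ 0`). -/
def poissonLaw (lam : ℝ) : Measure ℕ := poissonMeasure lam.toNNReal

/-- The one-sided mixture `(1 - ε) Pois(lam) + ε Pois(lam + Δ)`. -/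
def oneSidedMixture (ε lam Δ : ℝ) : Measure ℕ :=
  ENNReal.ofReal (1 - ε) • poissonLaw lam + ENNReal.ofReal ε • poissonLaw (lam + Δ)

/-- The joint law of `n` independent counts under the null, `X i ∼ Pois(lam i)`. -/
def nullLaw {n : ℕ} (lam : Fin n → ℝ) : Measure (Fin n → ℕ) :=
  Measure.pi fun i => poissonLaw (lam i)

/-- The joint law of `n` independent counts under the alternative,
`X i ∼ (1 - ε) Pois(lam i) + ε Pois(lam i + Δ i)`. -/
def altLaw {n : ℕ} (ε : ℝ) (lam Δ : Fin n → ℝ) : Measure (Fin n → ℕ) :=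
  Measure.pi fun i => oneSidedMixture ε (lam i) (Δ i)

/-- The one-sided Poisson p-value `P(Υ ≥ x)`, where `Υ ∼ Pois(lam)`. -/
def oneSidedPValue (lam : ℝ) (x : ℕ) : ℝ := (poissonLaw lam).real (Set.Ici x)

/-- Fisher's combination statistic `-2 ∑ log p i` of the one-sided p-values. -/
def fisherStat {n : ℕ} (lam : Fin n → ℝ) (x : Fin n → ℕ) : ℝ :=
  -2 * ∑ i, Real.log (oneSidedPValue (lam i) (x i))

/-- The risk of the test with rejection region `R`: the sum of the probabilities of type I and
type II errors. -/
def testRisk {Ω : Type*} [MeasurableSpace Ω] (P₀ P₁ : Measure Ω) (R : Set Ω) : ℝ≥0∞ :=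
  P₀ R + P₁ Rᶜ

/-- A sequence of statistics `T n` yields an asymptotically powerful test, rejecting for large
values: for suitable critical values `t n`, the risk of the test that rejects when `t n ≤ T n`
tends to zero. -/
def IsAsymptoticallyPowerful {Ω : ℕ → Type*} [∀ n, MeasurableSpace (Ω n)]
    (P₀ P₁ : ∀ n, Measure (Ω n)) (T : ∀ n, Ω n → ℝ) : Prop :=
  ∃ t : ℕ → ℝ, Tendsto (fun n => testRisk (P₀ n) (P₁ n) {x | t n ≤ T n x}) atTop (𝓝 0)

/-- In the one-sided model with parameters `lam n i`, `Δ n i`, `ε n`, Fisher's test of `ε = 0` is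
asymptotically powerful. -/
def FisherAsymptoticallyPowerful (ε : ℕ → ℝ) (lam Δ : ∀ n : ℕ, Fin n → ℝ) : Prop :=
  IsAsymptoticallyPowerful (fun n => nullLaw (lam n)) (fun n => altLaw (ε n) (lam n) (Δ n))
    (fun n => fisherStat (lam n))

end

/-! ### Poisson expectations -/

/-! Fisher's statistic is a sum of independent scores `-2 log p_i`, so Chebyshev's inequality
suffices: the variance is `O(n)` under both laws, and the means differ by at least a multiple of `S
= ε ∑ min(a_i, 1)`, so the risk is `O(n / S²)`.

Variance: under the null the p-value is stochastically at least uniform, so `E[p^{-1/2}] ≤ 2` and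
the score has bounded fourth moment. The likelihood ratio of a shift `d ≤ √λ` has second moment at
most `e`, which carries a second moment bound over to the alternative (`integral_fisherScore_sq`).

Mean: beyond `λ` the Poisson tail is at most `3√λ` times the mass, so each extra count there raises
the score by at least `2/(3√λ)`. The count reaches `λ` with probability at least `1/15`, and a shift
by `d` adds an independent `Pois(d)` (`integral_fisherScore_sub_ge`).

Shifts above `√λ` are truncated to `√λ`; by a monotone coupling this can only increase the type II
error (`altLaw_sum_lt_le`). -/

instance isProbabilityMeasure_poissonLaw (r : ℝ) : IsProbabilityMeasure (poissonLaw r) := by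
  unfold poissonLaw; infer_instance

theorem poissonLaw_real_singleton {r : ℝ} (hr : 0 ≤ r) (n : ℕ) :
    (poissonLaw r).real {n} = Real.exp (-r) * r ^ n / n.factorial := by
  rw [poissonLaw, poissonMeasure_real_singleton, Real.coe_toNNReal _ hr]

theorem integral_poissonLaw (r : ℝ) (f : ℕ → ℝ) :
    ∫ n, f n ∂poissonLaw r = ∑' n, (poissonLaw r).real {n} * f n := by
  simp_rw [poissonLaw, poissonMeasure_real_singleton, integral_poissonMeasure, smul_eq_mul]

theorem integrable_poissonLaw_iff {r : ℝ} {f : ℕ → ℝ} :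
    Integrable f (poissonLaw r) ↔ Summable fun n => (poissonLaw r).real {n} * f n := by
  rw [← summable_abs_iff]
  simp_rw [abs_mul, abs_of_nonneg measureReal_nonneg, poissonLaw, poissonMeasure_real_singleton,
    integrable_poissonMeasure_iff, Real.norm_eq_abs]

theorem poissonLaw_real_succ {r : ℝ} (hr : 0 ≤ r) (n : ℕ) :
    (n + 1 : ℝ) * (poissonLaw r).real {n + 1} = r * (poissonLaw r).real {n} := by
  rw [poissonLaw_real_singleton hr, poissonLaw_real_singleton hr, Nat.factorial_succ, pow_succ]
  push_cast
  field_simp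

/-- The Stein identity `E[X f(X)] = r E[f(X + 1)]` for `X ∼ Pois(r)`. -/
theorem integral_mul_self_poissonLaw {r : ℝ} (hr : 0 ≤ r) {f : ℕ → ℝ}
    (hf : Integrable (fun n => f (n + 1)) (poissonLaw r)) :
    Integrable (fun n : ℕ => n * f n) (poissonLaw r) ∧
      ∫ n : ℕ, n * f n ∂poissonLaw r = r * ∫ n, f (n + 1) ∂poissonLaw r := by
  have key : ∀ n : ℕ, (poissonLaw r).real {n + 1} * (((n + 1 : ℕ) : ℝ) * f (n + 1)) =
      r * ((poissonLaw r).real {n} * f (n + 1)) := fun n => by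
    have := poissonLaw_real_succ hr n
    push_cast
    linear_combination f (n + 1) * this
  have h1 : HasSum (fun n => r * ((poissonLaw r).real {n} * f (n + 1)))
      (r * ∫ n, f (n + 1) ∂poissonLaw r) := by
    rw [integral_poissonLaw]
    exact (integrable_poissonLaw_iff.1 hf).hasSum.mul_left r
  have h2 : HasSum (fun n => (poissonLaw r).real {n} * ((n : ℝ) * f n))
      (r * ∫ n, f (n + 1) ∂poissonLaw r) := by
    rw [← hasSum_nat_add_iff' 1]
    simpa only [key, Finset.sum_range_one, Nat.cast_zero, zero_mul, mul_zero, sub_zero] using h1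
  exact ⟨integrable_poissonLaw_iff.2 h2.summable, by rw [integral_poissonLaw, h2.tsum_eq]⟩

theorem integral_id_poissonLaw {r : ℝ} (hr : 0 ≤ r) :
    Integrable (fun n : ℕ => (n : ℝ)) (poissonLaw r) ∧ ∫ n : ℕ, (n : ℝ) ∂poissonLaw r = r := by
  simpa using integral_mul_self_poissonLaw hr (f := fun _ => 1) (integrable_const _)

theorem integral_sq_poissonLaw {r : ℝ} (hr : 0 ≤ r) :
    Integrable (fun n : ℕ => (n : ℝ) ^ 2) (poissonLaw r) ∧
      ∫ n : ℕ, (n : ℝ) ^ 2 ∂poissonLaw r = r ^ 2 + r := by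
  obtain ⟨i1, e1⟩ := integral_id_poissonLaw hr
  have h := integral_mul_self_poissonLaw hr (f := fun n => n)
    (by simpa using i1.add (integrable_const 1))
  simp only [← sq, Nat.cast_add, Nat.cast_one] at h
  rw [integral_add i1 (integrable_const _), e1] at h
  refine ⟨h.1, h.2.trans ?_⟩
  simp
  ring

theorem integral_cube_poissonLaw {r : ℝ} (hr : 0 ≤ r) :
    Integrable (fun n : ℕ => (n : ℝ) ^ 3) (poissonLaw r) ∧
      ∫ n : ℕ, (n : ℝ) ^ 3 ∂poissonLaw r = r ^ 3 + 3 * r ^ 2 + r := by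
  obtain ⟨i1, e1⟩ := integral_id_poissonLaw hr
  obtain ⟨i2, e2⟩ := integral_sq_poissonLaw hr
  have hE : ∀ n : ℕ, (((n + 1 : ℕ) : ℝ)) ^ 2 = (n : ℝ) ^ 2 + 2 * n + 1 := fun n => by
    push_cast; ring
  have i : Integrable (fun n : ℕ => (n : ℝ) ^ 2 + 2 * n) (poissonLaw r) :=
    i2.add (i1.const_mul 2)
  have h := integral_mul_self_poissonLaw hr (f := fun n => (n : ℝ) ^ 2)
    (by simp only [hE]; exact i.add (integrable_const 1))
  simp only [hE, ← pow_succ'] at h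
  rw [integral_add i (integrable_const _), integral_add i2 (i1.const_mul 2),
    integral_const_mul, e1, e2] at h
  refine ⟨h.1, h.2.trans ?_⟩
  simp
  ring

theorem integral_pow_four_poissonLaw {r : ℝ} (hr : 0 ≤ r) :
    Integrable (fun n : ℕ => (n : ℝ) ^ 4) (poissonLaw r) ∧
      ∫ n : ℕ, (n : ℝ) ^ 4 ∂poissonLaw r = r ^ 4 + 6 * r ^ 3 + 7 * r ^ 2 + r := by
  obtain ⟨i1, e1⟩ := integral_id_poissonLaw hr
  obtain ⟨i2, e2⟩ := integral_sq_poissonLaw hr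
  obtain ⟨i3, e3⟩ := integral_cube_poissonLaw hr
  have hE : ∀ n : ℕ, (((n + 1 : ℕ) : ℝ)) ^ 3 = (n : ℝ) ^ 3 + 3 * (n : ℝ) ^ 2 + 3 * n + 1 :=
    fun n => by push_cast; ring
  have i : Integrable (fun n : ℕ => (n : ℝ) ^ 3 + 3 * (n : ℝ) ^ 2) (poissonLaw r) :=
    i3.add (i2.const_mul 3)
  have i' : Integrable (fun n : ℕ => (n : ℝ) ^ 3 + 3 * (n : ℝ) ^ 2 + 3 * n) (poissonLaw r) :=
    i.add (i1.const_mul 3)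
  have h := integral_mul_self_poissonLaw hr (f := fun n => (n : ℝ) ^ 3)
    (by simp only [hE]; exact i'.add (integrable_const 1))
  simp only [hE, ← pow_succ'] at h
  rw [integral_add i' (integrable_const _), integral_add i (i1.const_mul 3),
    integral_add i3 (i2.const_mul 3), integral_const_mul, integral_const_mul, e1, e2, e3] at h
  refine ⟨h.1, h.2.trans ?_⟩
  simp
  ring

/-- A Poisson variable with mean at least `1` exceeds its mean with probability at least `1/15`. -/
theorem poissonLaw_real_mean_le {r : ℝ} (hr : 1 ≤ r) :
    1 / 15 ≤ (poissonLaw r).real {n : ℕ | r ≤ n} := by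
  have hr0 : 0 ≤ r := by linarith
  obtain ⟨i1, e1⟩ := integral_id_poissonLaw hr0
  obtain ⟨i2, e2⟩ := integral_sq_poissonLaw hr0
  obtain ⟨i3, e3⟩ := integral_cube_poissonLaw hr0
  obtain ⟨i4, e4⟩ := integral_pow_four_poissonLaw hr0
  set s := Real.sqrt r with hs
  have hs1 : 1 ≤ s := Real.one_le_sqrt.2 hr
  have hsr : r = s ^ 2 := (Real.sq_sqrt hr0).symm
  have hs0 : s ≠ 0 := by positivity
  -- With `w` the standardized count, `(5w + 5w² - w⁴)/15` lies below the indicator of `w ≥ 0`.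
  -- Since `E w = 0`, `E w² = 1` and `E w⁴ = 3 + 1/r`, its mean is `(2 - 1/r)/15 ≥ 1/15`.
  have hE : ∀ n : ℕ, (5 * ((n - r) / s) + 5 * ((n - r) / s) ^ 2 - ((n - r) / s) ^ 4) / 15 =
      (-1 / (15 * s ^ 4)) * (n : ℝ) ^ 4 + (4 * r / (15 * s ^ 4)) * (n : ℝ) ^ 3 +
      (1 / (3 * s ^ 2) - 6 * r ^ 2 / (15 * s ^ 4)) * (n : ℝ) ^ 2 +
      (1 / (3 * s) - 2 * r / (3 * s ^ 2) + 4 * r ^ 3 / (15 * s ^ 4)) * (n : ℝ) +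
      (- r / (3 * s) + r ^ 2 / (3 * s ^ 2) - r ^ 4 / (15 * s ^ 4)) := fun n => by
    field_simp
    ring
  have j4 := i4.const_mul (-1 / (15 * s ^ 4))
  have j3 := i3.const_mul (4 * r / (15 * s ^ 4))
  have j2 := i2.const_mul (1 / (3 * s ^ 2) - 6 * r ^ 2 / (15 * s ^ 4))
  have j1 := i1.const_mul (1 / (3 * s) - 2 * r / (3 * s ^ 2) + 4 * r ^ 3 / (15 * s ^ 4))
  have j0 := integrable_const (μ := poissonLaw r)
    (- r / (3 * s) + r ^ 2 / (3 * s ^ 2) - r ^ 4 / (15 * s ^ 4))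
  have hint : Integrable (fun n : ℕ =>
      (5 * ((n - r) / s) + 5 * ((n - r) / s) ^ 2 - ((n - r) / s) ^ 4) / 15) (poissonLaw r) := by
    simp only [hE]
    exact (((j4.add j3).add j2).add j1).add j0
  have hval : ∫ n : ℕ, (5 * ((n - r) / s) + 5 * ((n - r) / s) ^ 2 - ((n - r) / s) ^ 4) / 15
      ∂poissonLaw r = (2 - 1 / s ^ 2) / 15 := by
    simp only [hE]
    rw [integral_add (((j4.fun_add j3).fun_add j2).fun_add j1) j0,
      integral_add ((j4.fun_add j3).fun_add j2) j1, integral_add (j4.fun_add j3) j2,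
      integral_add j4 j3]
    simp only [integral_const_mul, e1, e2, e3, e4, integral_const, probReal_univ, smul_eq_mul]
    rw [hsr]
    field_simp
    ring
  have hmeas : MeasurableSet {n : ℕ | r ≤ n} := .of_discrete
  rw [← integral_indicator_one hmeas]
  have hle : ∀ n : ℕ, (5 * ((n - r) / s) + 5 * ((n - r) / s) ^ 2 - ((n - r) / s) ^ 4) / 15 ≤
      Set.indicator {n : ℕ | r ≤ n} (1 : ℕ → ℝ) n := fun n => by
    set w := ((n : ℝ) - r) / s with hw
    by_cases h : r ≤ n
    · rw [Set.indicator_of_mem (by exact h)]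
      have : 0 ≤ w := div_nonneg (by linarith) (by positivity)
      simp only [Pi.one_apply]
      -- `15 - 5w - 5w² + w⁴ = (w² - 13/4)² + (3/2)(w - 5/3)² + 13/48`.
      nlinarith [sq_nonneg (w ^ 2 - 13 / 4), sq_nonneg (w - 5 / 3)]
    · rw [Set.indicator_of_notMem (by exact h)]
      have : w ≤ 0 := div_nonpos_of_nonpos_of_nonneg (by linarith) (by positivity)
      have h3 : 0 ≤ 5 + 5 * w - w ^ 3 := by
        nlinarith [mul_nonneg (neg_nonneg.2 this) (sq_nonneg (w + 4 / 3)), sq_nonneg (w + 4 / 3)]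
      nlinarith
  refine le_trans ?_ (integral_mono hint ((integrable_const _).indicator hmeas) hle)
  rw [hval]
  have : 1 / s ^ 2 ≤ 1 := by rw [div_le_one (by positivity)]; nlinarith
  linarith

/-- The Mills ratio of the Poisson law: beyond the mean the tail is at most `3 √r` times the
probability mass. -/
theorem poissonLaw_real_Ici_le {r : ℝ} (hr : 1 ≤ r) {x : ℕ} (hx : r ≤ x) :
    (poissonLaw r).real (Set.Ici x) ≤ 3 * Real.sqrt r * (poissonLaw r).real {x} := by
  have hr0 : 0 ≤ r := by linarith
  set μ := poissonLaw r with hμ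
  set s := Real.sqrt r with hs
  have hs1 : 1 ≤ s := Real.one_le_sqrt.2 hr
  have hsr : s * s = r := Real.mul_self_sqrt hr0
  have hanti : ∀ j : ℕ, μ.real {x + j} ≤ μ.real {x} := fun j => by
    induction j with
    | zero => simp
    | succ j ih =>
      refine le_trans ?_ ih
      have h := poissonLaw_real_succ hr0 (x + j)
      rw [← hμ] at h
      have h0 : 0 ≤ μ.real {x + j + 1} := measureReal_nonneg
      have h0' : 0 ≤ μ.real {x + j} := measureReal_nonneg
      push_cast at h
      have hj : (0 : ℝ) ≤ j := by positivity
      rw [← add_assoc]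
      by_contra hlt
      push Not at hlt
      nlinarith
  -- The tail is cut at `x + K`. The near part has `K < s + 1` masses, each at most that of `x`; the
  -- far part is at most `s` such masses. Together `2s + 1 ≤ 3s`.
  set K := ⌈s⌉₊ with hK
  have hK1 : s ≤ K := Nat.le_ceil s
  have hK2 : (K : ℝ) < s + 1 := Nat.ceil_lt_add_one (by positivity)
  have hsplit : μ.real (Set.Ici x) = ∑ j ∈ Finset.range K, μ.real {x + j} +
      μ.real (Set.Ici (x + K)) := by
    generalize K = k
    induction k with
    | zero => simp
    | succ k ih =>
      have : Set.Ici (x + k) = {x + k} ∪ Set.Ici (x + k + 1) := by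
        ext; simp; omega
      rw [ih, Finset.sum_range_succ, this, measureReal_union (by simp) .of_discrete]
      ring_nf
  -- The Stein identity for the indicator of `X ≥ x + 1` gives `E[(X - r) 1{X ≥ x + 1}] = r P(X =
  -- x)`, and `X - r ≥ K` once `X ≥ x + K`.
  have hfar : K * μ.real (Set.Ici (x + K)) ≤ r * μ.real {x} := by
    have hst := integral_mul_self_poissonLaw hr0 (f := Set.indicator (Set.Ici (x + 1)) 1)
      (.of_bound .of_discrete 1 (.of_forall fun n => by
        simp only [Set.indicator, Pi.one_apply]; split_ifs <;> simp))
    have hshift : (fun n : ℕ => Set.indicator (Set.Ici (x + 1)) (1 : ℕ → ℝ) (n + 1)) =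
        Set.indicator (Set.Ici x) 1 := by
      ext n; simp [Set.indicator]
    rw [hshift, integral_indicator_one .of_discrete, ← hμ] at hst
    have hx1 : μ.real (Set.Ici x) = μ.real {x} + μ.real (Set.Ici (x + 1)) := by
      have : Set.Ici x = {x} ∪ Set.Ici (x + 1) := by ext; simp; omega
      rw [this, measureReal_union (by simp) .of_discrete]
    have hind : ∀ A : Set ℕ, Integrable (Set.indicator A (1 : ℕ → ℝ)) μ := fun A =>
      (integrable_const (1 : ℝ)).indicator .of_discrete
    have hmono : ∫ n, (K : ℝ) * Set.indicator (Set.Ici (x + K)) 1 n ∂μ ≤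
        ∫ n : ℕ, ((n : ℝ) * Set.indicator (Set.Ici (x + 1)) 1 n -
          r * Set.indicator (Set.Ici (x + 1)) 1 n) ∂μ := by
      refine integral_mono ((hind _).const_mul _) (hst.1.sub ((hind _).const_mul r)) fun n => ?_
      have hKpos : 1 ≤ K := Nat.one_le_ceil_iff.2 (by positivity)
      by_cases h1 : x + K ≤ n
      · have h1' : ((x + K : ℕ) : ℝ) ≤ n := by exact_mod_cast h1
        have h2 : x + 1 ≤ n := by omega
        push_cast at h1'
        simp [Set.indicator, h1, h2]
        linarith
      · by_cases h2 : x + 1 ≤ n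
        · have h2' : ((x + 1 : ℕ) : ℝ) ≤ n := by exact_mod_cast h2
          push_cast at h2'
          simp [Set.indicator, h1, h2]
          linarith
        · simp [Set.indicator, h1, h2]
    rw [integral_sub hst.1 ((hind _).const_mul r), hst.2, integral_const_mul, integral_const_mul,
      integral_indicator_one .of_discrete, integral_indicator_one .of_discrete, hx1] at hmono
    linarith
  have hnear : ∑ j ∈ Finset.range K, μ.real {x + j} ≤ K * μ.real {x} := by
    simpa using Finset.sum_le_card_nsmul (Finset.range K) _ _ fun j _ => hanti j
  have hp : 0 ≤ μ.real {x} := measureReal_nonneg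
  have hq : 0 ≤ μ.real (Set.Ici (x + K)) := measureReal_nonneg
  have hfar' : μ.real (Set.Ici (x + K)) ≤ s * μ.real {x} := by
    have : s * μ.real (Set.Ici (x + K)) ≤ s * (s * μ.real {x}) := by nlinarith
    exact le_of_mul_le_mul_left this (by positivity)
  rw [hsplit]
  nlinarith

/-! ### The one-sided p-value -/

theorem poissonLaw_real_singleton_pos {r : ℝ} (hr : 0 < r) (n : ℕ) :
    0 < (poissonLaw r).real {n} :=
  poissonMeasure_real_singleton_pos n (Real.toNNReal_pos.2 hr)

theorem oneSidedPValue_pos {r : ℝ} (hr : 0 < r) (x : ℕ) : 0 < oneSidedPValue r x :=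
  (poissonLaw_real_singleton_pos hr x).trans_le (measureReal_mono (by simp))

theorem oneSidedPValue_le_one (r : ℝ) (x : ℕ) : oneSidedPValue r x ≤ 1 :=
  measureReal_le_one

theorem oneSidedPValue_antitone (r : ℝ) : Antitone (oneSidedPValue r) := fun _ _ h =>
  measureReal_mono (Set.Ici_subset_Ici.2 h)

theorem oneSidedPValue_eq_add (r : ℝ) (x : ℕ) :
    oneSidedPValue r x = (poissonLaw r).real {x} + oneSidedPValue r (x + 1) := by
  have : Set.Ici x = {x} ∪ Set.Ici (x + 1) := by ext; simp; omega
  rw [oneSidedPValue, this, measureReal_union (by simp) .of_discrete, oneSidedPValue]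

/-- `E[p^{-1/2}] ≤ 2` for a one-sided p-value `p` under the null. -/
theorem integral_inv_sqrt_oneSidedPValue {r : ℝ} (hr : 0 < r) :
    Integrable (fun x => (Real.sqrt (oneSidedPValue r x))⁻¹) (poissonLaw r) ∧
      ∫ x, (Real.sqrt (oneSidedPValue r x))⁻¹ ∂poissonLaw r ≤ 2 := by
  have hnn : ∀ x, 0 ≤ (poissonLaw r).real {x} * (Real.sqrt (oneSidedPValue r x))⁻¹ := fun x => by
    have : 0 ≤ (poissonLaw r).real {x} := measureReal_nonneg
    positivity
  -- With `a`, `b` the square roots of consecutive tails, the mass is `a² - b² = (a - b)(a + b) ≤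
  -- 2a(a - b)`; the resulting bound telescopes.
  have hstep : ∀ x, (poissonLaw r).real {x} * (Real.sqrt (oneSidedPValue r x))⁻¹ ≤
      2 * (Real.sqrt (oneSidedPValue r x) - Real.sqrt (oneSidedPValue r (x + 1))) := fun x => by
    have hp := oneSidedPValue_pos hr x
    have hp' := oneSidedPValue_pos hr (x + 1)
    have h := oneSidedPValue_eq_add r x
    have ha := Real.sq_sqrt hp.le
    have hb := Real.sq_sqrt hp'.le
    have hle := Real.sqrt_le_sqrt (oneSidedPValue_antitone r (Nat.le_succ x))
    have hpos := Real.sqrt_pos.2 hp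
    have hpos' := Real.sqrt_pos.2 hp'
    rw [← div_eq_mul_inv, div_le_iff₀ hpos]
    simp only [Nat.succ_eq_add_one] at hle
    nlinarith
  have hsum : ∀ n, ∑ x ∈ Finset.range n,
      (poissonLaw r).real {x} * (Real.sqrt (oneSidedPValue r x))⁻¹ ≤ 2 := fun n => by
    refine (Finset.sum_le_sum fun x _ => hstep x).trans ?_
    rw [← Finset.mul_sum, Finset.sum_range_sub']
    have h1 : Real.sqrt (oneSidedPValue r 0) ≤ 1 := Real.sqrt_le_one.2 (oneSidedPValue_le_one r 0)
    have h2 := Real.sqrt_nonneg (oneSidedPValue r n)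
    linarith
  refine ⟨integrable_poissonLaw_iff.2 (summable_of_sum_range_le hnn hsum), ?_⟩
  rw [integral_poissonLaw]
  exact Real.tsum_le_of_sum_range_le hnn hsum

/-- The contribution of a single count to Fisher's statistic. -/
noncomputable def fisherScore (r : ℝ) (x : ℕ) : ℝ := -2 * Real.log (oneSidedPValue r x)

theorem fisherScore_nonneg (r : ℝ) (x : ℕ) : 0 ≤ fisherScore r x := by
  have := Real.log_nonpos (x := oneSidedPValue r x) measureReal_nonneg (oneSidedPValue_le_one r x)
  unfold fisherScore
  linarith

theorem fisherScore_monotone {r : ℝ} (hr : 0 < r) : Monotone (fisherScore r) := fun x y h => by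
  have := Real.log_le_log (oneSidedPValue_pos hr y) (oneSidedPValue_antitone r h)
  unfold fisherScore
  linarith

/-- This is `y⁴/4! ≤ exp y` at a quarter of the score, where `exp y = p^{-1/2}`; the constant is `4⁴
· 4!`. -/
theorem fisherScore_pow_four_le {r : ℝ} (hr : 0 < r) (x : ℕ) :
    fisherScore r x ^ 4 ≤ 6144 * (Real.sqrt (oneSidedPValue r x))⁻¹ := by
  have hp := oneSidedPValue_pos hr x
  have h := Real.pow_div_factorial_le_exp (fisherScore r x / 4)
    (div_nonneg (fisherScore_nonneg r x) (by norm_num)) 4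
  have he : Real.exp (fisherScore r x / 4) = (Real.sqrt (oneSidedPValue r x))⁻¹ := by
    rw [← Real.exp_log (inv_pos.2 (Real.sqrt_pos.2 hp)), Real.log_inv, Real.log_sqrt hp.le,
      fisherScore]
    ring_nf
  rw [he, div_pow, show ((Nat.factorial 4 : ℕ) : ℝ) = 24 by norm_num [Nat.factorial]] at h
  linarith

theorem integral_fisherScore_pow_four {r : ℝ} (hr : 0 < r) :
    Integrable (fun x => fisherScore r x ^ 4) (poissonLaw r) ∧
      ∫ x, fisherScore r x ^ 4 ∂poissonLaw r ≤ 12288 := by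
  obtain ⟨hi, hle⟩ := integral_inv_sqrt_oneSidedPValue hr
  have hi' := hi.const_mul 6144
  have hint : Integrable (fun x => fisherScore r x ^ 4) (poissonLaw r) :=
    hi'.mono' .of_discrete (.of_forall fun x => by
      rw [Real.norm_of_nonneg (pow_nonneg (fisherScore_nonneg r x) 4)]
      exact fisherScore_pow_four_le hr x)
  refine ⟨hint, (integral_mono hint hi' (fisherScore_pow_four_le hr)).trans ?_⟩
  rw [integral_const_mul]
  linarith

/-- The likelihood ratio of `Pois(r + d)` against `Pois(r)` has second moment `exp (d² / r)`. -/
theorem integral_sq_likelihoodRatio {r d : ℝ} (hr : 0 < r) :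
    Integrable (fun x : ℕ => (Real.exp (-d) * (1 + d / r) ^ x) ^ 2) (poissonLaw r) ∧
      ∫ x : ℕ, (Real.exp (-d) * (1 + d / r) ^ x) ^ 2 ∂poissonLaw r = Real.exp (d ^ 2 / r) := by
  have h := (NormedSpace.expSeries_div_hasSum_exp (r * (1 + d / r) ^ 2)).mul_left
    (Real.exp (-r - 2 * d))
  rw [← Real.exp_eq_exp_ℝ, ← Real.exp_add] at h
  have he : -r - 2 * d + r * (1 + d / r) ^ 2 = d ^ 2 / r := by field_simp; ring
  have hf : ∀ x : ℕ, (poissonLaw r).real {x} * (Real.exp (-d) * (1 + d / r) ^ x) ^ 2 =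
      Real.exp (-r - 2 * d) * ((r * (1 + d / r) ^ 2) ^ x / x.factorial) := fun x => by
    rw [poissonLaw_real_singleton hr.le, show -r - 2 * d = -r + (-d + -d) by ring, Real.exp_add,
      Real.exp_add, mul_pow r, ← pow_mul, mul_comm 2 x, pow_mul]
    ring
  rw [he] at h
  simp only [← hf] at h
  exact ⟨integrable_poissonLaw_iff.2 h.summable, by rw [integral_poissonLaw, h.tsum_eq]⟩

/-- Change of measure: with `L` the likelihood ratio and `f` the score, `L f² ≤ (f⁴ + L²)/2`. The
condition `d ≤ √r` keeps `E[L²] = exp(d²/r)` below `3`, and `(12288 + 3)/2 ≤ 6146`. -/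
theorem integral_fisherScore_sq {r d : ℝ} (hr : 0 < r) (hd : 0 ≤ d) (hdr : d ≤ Real.sqrt r) :
    Integrable (fun x => fisherScore r x ^ 2) (poissonLaw (r + d)) ∧
      ∫ x, fisherScore r x ^ 2 ∂poissonLaw (r + d) ≤ 6146 := by
  obtain ⟨i4, h4⟩ := integral_fisherScore_pow_four hr
  obtain ⟨iL, hL⟩ := integral_sq_likelihoodRatio (d := d) hr
  have hbound : ∀ x, (poissonLaw (r + d)).real {x} * fisherScore r x ^ 2 ≤
      (poissonLaw r).real {x} *
        ((fisherScore r x ^ 4 + (Real.exp (-d) * (1 + d / r) ^ x) ^ 2) / 2) := fun x => by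
    have hlr : (poissonLaw (r + d)).real {x} =
        (poissonLaw r).real {x} * (Real.exp (-d) * (1 + d / r) ^ x) := by
      rw [poissonLaw_real_singleton hr.le, poissonLaw_real_singleton (by positivity),
        show r + d = r * (1 + d / r) by field_simp, mul_pow,
        show -(r * (1 + d / r)) = -r + -d by field_simp; ring, Real.exp_add]
      ring
    rw [hlr, mul_assoc]
    refine mul_le_mul_of_nonneg_left ?_ measureReal_nonneg
    nlinarith [sq_nonneg (fisherScore r x ^ 2 - Real.exp (-d) * (1 + d / r) ^ x)]
  have hi := (i4.add iL).div_const 2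
  have hs := integrable_poissonLaw_iff.1 hi
  have hs' : Summable fun x => (poissonLaw (r + d)).real {x} * fisherScore r x ^ 2 :=
    .of_nonneg_of_le (fun x => mul_nonneg measureReal_nonneg (sq_nonneg _)) hbound hs
  refine ⟨integrable_poissonLaw_iff.2 hs', ?_⟩
  have hsum := hs'.tsum_le_tsum hbound hs
  rw [← integral_poissonLaw] at hsum
  refine hsum.trans ?_
  have he : Real.exp (d ^ 2 / r) ≤ 3 := by
    have : d ^ 2 / r ≤ 1 := by
      rw [div_le_one hr, ← Real.sq_sqrt hr.le]
      exact pow_le_pow_left₀ hd hdr 2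
    linarith [Real.exp_le_exp.2 this, Real.exp_one_lt_d9]
  have hval := integral_poissonLaw r fun x =>
    (fisherScore r x ^ 4 + (Real.exp (-d) * (1 + d / r) ^ x) ^ 2) / 2
  rw [integral_div, integral_add i4 iL, hL] at hval
  change ∑' x, _ * ((fisherScore r x ^ 4 + (Real.exp (-d) * (1 + d / r) ^ x) ^ 2) / 2) ≤ _
  rw [← hval]
  linarith

theorem memLp_fisherScore {r d : ℝ} (hr : 0 < r) (hd : 0 ≤ d) (hdr : d ≤ Real.sqrt r) :
    MemLp (fisherScore r) 2 (poissonLaw (r + d)) :=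
  (memLp_two_iff_integrable_sq .of_discrete).2 (integral_fisherScore_sq hr hd hdr).1

/-- By `log u ≤ u - 1`, the increment is at least twice the ratio of mass to tail at `x`, which the
Mills bound controls from below. -/
theorem fisherScore_succ_sub {r : ℝ} (hr : 1 ≤ r) {x : ℕ} (hx : r ≤ x) :
    2 / 3 / Real.sqrt r ≤ fisherScore r (x + 1) - fisherScore r x := by
  have hr0 : 0 < r := by linarith
  have hs : 0 < Real.sqrt r := Real.sqrt_pos.2 hr0
  have hp := oneSidedPValue_pos hr0 x
  have hp' := oneSidedPValue_pos hr0 (x + 1)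
  have hlog := Real.log_le_sub_one_of_pos (div_pos hp' hp)
  rw [Real.log_div hp'.ne' hp.ne'] at hlog
  have hm : oneSidedPValue r x ≤ 3 * Real.sqrt r * (poissonLaw r).real {x} :=
    poissonLaw_real_Ici_le hr hx
  have hstep : 1 / (3 * Real.sqrt r) ≤ 1 - oneSidedPValue r (x + 1) / oneSidedPValue r x := by
    rw [one_sub_div hp.ne', div_le_div_iff₀ (by positivity) hp, oneSidedPValue_eq_add r x,
      add_sub_cancel_right, ← oneSidedPValue_eq_add]
    linarith
  have : 2 / 3 / Real.sqrt r = 2 * (1 / (3 * Real.sqrt r)) := by field_simp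
  rw [this]
  unfold fisherScore
  linarith

theorem fisherScore_add_ge {r : ℝ} (hr : 1 ≤ r) (x y : ℕ) :
    fisherScore r x + 2 / 3 / Real.sqrt r * (Set.indicator {n : ℕ | r ≤ n} 1 x * y) ≤
      fisherScore r (x + y) := by
  have hr0 : 0 < r := by linarith
  by_cases hx : r ≤ x
  · rw [Set.indicator_of_mem (by exact hx), Pi.one_apply, one_mul]
    induction y with
    | zero => simp
    | succ y ih =>
      have h := fisherScore_succ_sub hr (x := x + y) (by push_cast; linarith [y.cast_nonneg (α := ℝ)])
      rw [← add_assoc]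
      push_cast
      linarith
  · rw [Set.indicator_of_notMem (by exact hx), zero_mul, mul_zero, add_zero]
    exact fisherScore_monotone hr0 (Nat.le_add_right x y)

theorem poissonLaw_add {r d : ℝ} (hr : 0 ≤ r) (hd : 0 ≤ d) :
    poissonLaw (r + d) =
      ((poissonLaw r).prod (poissonLaw d)).map (fun q : ℕ × ℕ => q.1 + q.2) := by
  rw [poissonLaw, Real.toNNReal_add hr hd, ← poissonMeasure_conv_poissonMeasure]
  rfl

/-- Raising the mean of the count by `d ≤ √r` raises the expected score by a multiple of
`d / √r`. -/
theorem integral_fisherScore_sub_ge {r d : ℝ} (hr : 1 ≤ r) (hd : 0 ≤ d) (hdr : d ≤ Real.sqrt r) :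
    2 / 45 * (d / Real.sqrt r) ≤
      ∫ x, fisherScore r x ∂poissonLaw (r + d) - ∫ x, fisherScore r x ∂poissonLaw r := by
  have hr0 : 0 < r := by linarith
  have hs : 0 < Real.sqrt r := Real.sqrt_pos.2 hr0
  have hI : Integrable (fisherScore r) (poissonLaw (r + d)) :=
    (memLp_fisherScore hr0 hd hdr).integrable (by norm_num)
  have hI0 : Integrable (fisherScore r) (poissonLaw r) := by
    simpa using (memLp_fisherScore hr0 le_rfl (Real.sqrt_nonneg r)).integrable (by norm_num)
  obtain ⟨hid, hed⟩ := integral_id_poissonLaw hd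
  have hind : Integrable (Set.indicator {n : ℕ | r ≤ n} (1 : ℕ → ℝ)) (poissonLaw r) :=
    (integrable_const (1 : ℝ)).indicator .of_discrete
  have h1 : Integrable (fun q : ℕ × ℕ => fisherScore r (q.1 + q.2))
      ((poissonLaw r).prod (poissonLaw d)) := by
    rw [poissonLaw_add hr0.le hd] at hI
    exact hI.comp_measurable .of_discrete
  have h2 : Integrable (fun q : ℕ × ℕ => fisherScore r q.1)
      ((poissonLaw r).prod (poissonLaw d)) := hI0.comp_fst _
  have h3 : Integrable (fun q : ℕ × ℕ => 2 / 3 / Real.sqrt r *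
      (Set.indicator {n : ℕ | r ≤ n} (1 : ℕ → ℝ) q.1 * (q.2 : ℝ)))
      ((poissonLaw r).prod (poissonLaw d)) := (hind.mul_prod hid).const_mul _
  -- Integrating the pointwise gain over independent `Pois(r)` and `Pois(d)` counts yields the
  -- constant `2/3 · 1/15 = 2/45`.
  have hmono := integral_mono (h2.add h3) h1 fun q => fisherScore_add_ge hr q.1 q.2
  rw [integral_add' h2 h3, integral_const_mul,
    integral_prod_mul (Set.indicator {n : ℕ | r ≤ n} (1 : ℕ → ℝ)) (fun n : ℕ => (n : ℝ)), hed,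
    integral_indicator_one .of_discrete, integral_fun_fst, probReal_univ, one_smul] at hmono
  rw [poissonLaw_add hr0.le hd, integral_map (by fun_prop) .of_discrete]
  have hmean := mul_le_mul_of_nonneg_left (poissonLaw_real_mean_le hr)
    (show 0 ≤ 2 / 3 * (d / Real.sqrt r) by positivity)
  have : 2 / 3 / Real.sqrt r * ((poissonLaw r).real {n : ℕ | r ≤ n} * d) =
    2 / 3 * (d / Real.sqrt r) * (poissonLaw r).real {n : ℕ | r ≤ n} := by ring
  linarith

/-! ### Separation of sums in product spaces -/

theorem measure_pi_abs_sum_sub_ge {ι Ω : Type*} [Fintype ι] [MeasurableSpace Ω]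
    (μ : ι → Measure Ω) [∀ i, IsProbabilityMeasure (μ i)] (g : ι → Ω → ℝ)
    (hg : ∀ i, MemLp (g i) 2 (μ i)) {C d : ℝ} (hC : ∀ i, ∫ x, g i x ^ 2 ∂μ i ≤ C) (hd : 0 < d) :
    Measure.pi μ {x | d ≤ |∑ i, g i (x i) - ∑ i, ∫ y, g i y ∂μ i|} ≤
      ENNReal.ofReal (Fintype.card ι * C / d ^ 2) := by
  have hcomp : ∀ i, MemLp (fun x : ι → Ω => g i (x i)) 2 (Measure.pi μ) := fun i =>
    (hg i).comp_measurePreserving (measurePreserving_eval μ i)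
  have hmem : MemLp (∑ i, fun x : ι → Ω => g i (x i)) 2 (Measure.pi μ) :=
    memLp_finsetSum' _ fun i _ => hcomp i
  have hmean : ∫ x, (∑ i, fun x : ι → Ω => g i (x i)) x ∂Measure.pi μ =
      ∑ i, ∫ y, g i y ∂μ i := by
    simp only [Finset.sum_apply]
    rw [integral_finsetSum _ fun i _ => (hcomp i).integrable (by norm_num)]
    exact Finset.sum_congr rfl fun i _ => integral_comp_eval (hg i).aestronglyMeasurable
  have hvar : Var[∑ i, fun x : ι → Ω => g i (x i); Measure.pi μ] ≤ Fintype.card ι * C := by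
    rw [variance_sum_pi hg]
    simpa using Finset.sum_le_card_nsmul Finset.univ _ C fun i _ =>
      (variance_le_expectation_sq (hg i).aestronglyMeasurable).trans (hC i)
  have h := meas_ge_le_variance_div_sq hmem hd
  rw [hmean] at h
  simp only [Finset.sum_apply] at h
  exact h.trans (ENNReal.ofReal_le_ofReal (by gcongr))

/-- Two product laws whose means of `∑ g i` differ by at least `2 d` are separated by a threshold on
`∑ g i`. -/
theorem testRisk_pi_le {ι Ω : Type*} [Fintype ι] [MeasurableSpace Ω]
    (μ ν : ι → Measure Ω) [∀ i, IsProbabilityMeasure (μ i)] [∀ i, IsProbabilityMeasure (ν i)]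
    (g : ι → Ω → ℝ) (hμ : ∀ i, MemLp (g i) 2 (μ i)) (hν : ∀ i, MemLp (g i) 2 (ν i)) {C d : ℝ}
    (hCμ : ∀ i, ∫ x, g i x ^ 2 ∂μ i ≤ C) (hCν : ∀ i, ∫ x, g i x ^ 2 ∂ν i ≤ C) (hd : 0 < d)
    (hsep : 2 * d ≤ ∑ i, (∫ x, g i x ∂ν i - ∫ x, g i x ∂μ i)) :
    testRisk (Measure.pi μ) (Measure.pi ν)
        {x | (∑ i, ∫ y, g i y ∂μ i) + d ≤ ∑ i, g i (x i)} ≤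
      2 * ENNReal.ofReal (Fintype.card ι * C / d ^ 2) := by
  rw [two_mul, testRisk]
  rw [Finset.sum_sub_distrib] at hsep
  refine add_le_add ((measure_mono fun x hx => ?_).trans (measure_pi_abs_sum_sub_ge μ g hμ hCμ hd))
    ((measure_mono fun x hx => ?_).trans (measure_pi_abs_sum_sub_ge ν g hν hCν hd))
  · simp only [Set.mem_ofPred_eq] at hx ⊢
    exact (le_sub_iff_add_le'.2 hx).trans (le_abs_self _)
  · simp only [Set.mem_compl_iff, Set.mem_ofPred_eq, not_le] at hx ⊢
    refine le_trans ?_ (neg_le_abs _)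
    linarith

/-! ### The one-sided mixture -/

theorem isProbabilityMeasure_convexComb {Ω : Type*} [MeasurableSpace Ω] (μ ν : Measure Ω)
    [IsProbabilityMeasure μ] [IsProbabilityMeasure ν] {ε : ℝ} (h0 : 0 ≤ ε) (h1 : ε ≤ 1) :
    IsProbabilityMeasure (ENNReal.ofReal (1 - ε) • μ + ENNReal.ofReal ε • ν) := by
  constructor
  simp only [Measure.add_apply, Measure.smul_apply, measure_univ, smul_eq_mul, mul_one]
  rw [← ENNReal.ofReal_add (by linarith) h0]
  simp

theorem isProbabilityMeasure_oneSidedMixture {ε : ℝ} (h0 : 0 ≤ ε) (h1 : ε ≤ 1) (lam Δ : ℝ) :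
    IsProbabilityMeasure (oneSidedMixture ε lam Δ) :=
  isProbabilityMeasure_convexComb _ _ h0 h1

theorem integrable_oneSidedMixture {ε lam Δ : ℝ} {f : ℕ → ℝ} (hf : Integrable f (poissonLaw lam))
    (hf' : Integrable f (poissonLaw (lam + Δ))) : Integrable f (oneSidedMixture ε lam Δ) :=
  (hf.smul_measure ENNReal.ofReal_ne_top).add_measure (hf'.smul_measure ENNReal.ofReal_ne_top)

theorem integral_oneSidedMixture {ε lam Δ : ℝ} (h0 : 0 ≤ ε) (h1 : ε ≤ 1) {f : ℕ → ℝ}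
    (hf : Integrable f (poissonLaw lam)) (hf' : Integrable f (poissonLaw (lam + Δ))) :
    ∫ x, f x ∂oneSidedMixture ε lam Δ =
      (1 - ε) * ∫ x, f x ∂poissonLaw lam + ε * ∫ x, f x ∂poissonLaw (lam + Δ) := by
  rw [oneSidedMixture, integral_add_measure (hf.smul_measure ENNReal.ofReal_ne_top)
    (hf'.smul_measure ENNReal.ofReal_ne_top), integral_smul_measure, integral_smul_measure,
    ENNReal.toReal_ofReal h0, ENNReal.toReal_ofReal (by linarith), smul_eq_mul, smul_eq_mul]

/-- Mixtures with a larger shift are stochastically larger, as witnessed by a coupling. -/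
theorem exists_coupling_oneSidedMixture {ε lam d Δ : ℝ} (h0 : 0 ≤ ε) (h1 : ε ≤ 1) (hlam : 0 ≤ lam)
    (hd : 0 ≤ d) (hdΔ : d ≤ Δ) :
    ∃ κ : Measure (ℕ × ℕ), IsProbabilityMeasure κ ∧ κ.map Prod.fst = oneSidedMixture ε lam d ∧
      κ.map (fun q => q.1 + q.2) = oneSidedMixture ε lam Δ := by
  -- Both mixtures share the component label: the increment is `Pois(0)`, that is `0`, on the null
  -- component and `Pois(Δ - d)` on the shifted one.
  refine ⟨ENNReal.ofReal (1 - ε) • (poissonLaw lam).prod (poissonLaw 0) +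
    ENNReal.ofReal ε • (poissonLaw (lam + d)).prod (poissonLaw (Δ - d)),
    isProbabilityMeasure_convexComb _ _ h0 h1, ?_, ?_⟩
  · rw [Measure.map_add _ _ (by fun_prop), Measure.map_smul, Measure.map_smul,
      Measure.map_fst_prod, Measure.map_fst_prod]
    simp [oneSidedMixture]
  · rw [Measure.map_add _ _ (by fun_prop), Measure.map_smul, Measure.map_smul,
      ← poissonLaw_add hlam le_rfl, ← poissonLaw_add (by positivity) (by linarith)]
    simp [oneSidedMixture]

/-- The distribution function of a monotone statistic decreases when the shifts increase. -/
theorem altLaw_sum_lt_le {n : ℕ} {ε : ℝ} (h0 : 0 ≤ ε) (h1 : ε ≤ 1) {lam d Δ : Fin n → ℝ}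
    (hlam : ∀ i, 0 ≤ lam i) (hd : ∀ i, 0 ≤ d i) (hdΔ : ∀ i, d i ≤ Δ i) {g : Fin n → ℕ → ℝ}
    (hg : ∀ i, Monotone (g i)) (t : ℝ) :
    altLaw ε lam Δ {x | t ≤ ∑ i, g i (x i)}ᶜ ≤ altLaw ε lam d {x | t ≤ ∑ i, g i (x i)}ᶜ := by
  choose κ hκ hfst hadd using fun i =>
    exists_coupling_oneSidedMixture h0 h1 (hlam i) (hd i) (hdΔ i)
  have e1 : altLaw ε lam d = (Measure.pi κ).map fun q i => (q i).1 := by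
    have : ∀ i, IsProbabilityMeasure ((κ i).map Prod.fst) := fun i =>
      Measure.isProbabilityMeasure_map (by fun_prop)
    rw [Measure.pi_map_pi (μ := κ) (f := fun _ q => q.1) fun i => by fun_prop]
    exact congrArg Measure.pi (funext fun i => (hfst i).symm)
  have e2 : altLaw ε lam Δ = (Measure.pi κ).map fun q i => (q i).1 + (q i).2 := by
    have : ∀ i, IsProbabilityMeasure ((κ i).map fun q => q.1 + q.2) := fun i =>
      Measure.isProbabilityMeasure_map (by fun_prop)
    rw [Measure.pi_map_pi (μ := κ) (f := fun _ q => q.1 + q.2) fun i => by fun_prop]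
    exact congrArg Measure.pi (funext fun i => (hadd i).symm)
  rw [e1, e2, Measure.map_apply (by fun_prop) .of_discrete,
    Measure.map_apply (by fun_prop) .of_discrete]
  refine measure_mono fun q hq => ?_
  simp only [Set.mem_preimage, Set.mem_compl_iff, Set.mem_ofPred_eq, not_le] at hq ⊢
  exact (Finset.sum_le_sum fun i _ => hg i (Nat.le_add_right _ _)).trans_lt hq

/-! ### Fisher's test -/

theorem fisherStat_eq_sum {n : ℕ} (lam : Fin n → ℝ) (x : Fin n → ℕ) :
    fisherStat lam x = ∑ i, fisherScore (lam i) (x i) :=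
  Finset.mul_sum ..

/-- The risk of Fisher's test, in terms of the total standardized shift. -/
theorem exists_testRisk_fisherStat_le {n : ℕ} {ε : ℝ} (h0 : 0 ≤ ε) (h1 : ε ≤ 1)
    {lam Δ : Fin n → ℝ} (hlam : ∀ i, 1 ≤ lam i) (hΔ : ∀ i, 0 ≤ Δ i)
    (hS : 0 < ε * ∑ i, min (Δ i / Real.sqrt (lam i)) 1) :
    ∃ t : ℝ, testRisk (nullLaw lam) (altLaw ε lam Δ) {x | t ≤ fisherStat lam x} ≤
      2 * ENNReal.ofReal
        (n * 6146 / (1 / 45 * (ε * ∑ i, min (Δ i / Real.sqrt (lam i)) 1)) ^ 2) := by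
  set S := ε * ∑ i, min (Δ i / Real.sqrt (lam i)) 1 with hSdef
  -- Truncation at `√λ` keeps second moments bounded and loses nothing in `S`, since `d / √λ =
  -- min(a, 1)`.
  set d : Fin n → ℝ := fun i => min (Δ i) (Real.sqrt (lam i)) with hd
  have hlam0 : ∀ i, 0 < lam i := fun i => by linarith [hlam i]
  have hd0 : ∀ i, 0 ≤ d i := fun i => le_min (hΔ i) (Real.sqrt_nonneg _)
  have hds : ∀ i, d i ≤ Real.sqrt (lam i) := fun i => min_le_right _ _
  have hdmin : ∀ i, min (Δ i / Real.sqrt (lam i)) 1 = d i / Real.sqrt (lam i) := fun i => by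
    have hs := Real.sqrt_pos.2 (hlam0 i)
    rw [hd, ← min_div_div_right hs.le, div_self hs.ne']
  have hprob : ∀ i, IsProbabilityMeasure (oneSidedMixture ε (lam i) (d i)) := fun i =>
    isProbabilityMeasure_oneSidedMixture h0 h1 _ _
  have hm0 : ∀ i, MemLp (fisherScore (lam i)) 2 (poissonLaw (lam i)) := fun i => by
    simpa using memLp_fisherScore (hlam0 i) le_rfl (Real.sqrt_nonneg _)
  have hmd : ∀ i, MemLp (fisherScore (lam i)) 2 (poissonLaw (lam i + d i)) := fun i =>
    memLp_fisherScore (hlam0 i) (hd0 i) (hds i)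
  have hsq0 : ∀ i, ∫ x, fisherScore (lam i) x ^ 2 ∂poissonLaw (lam i) ≤ 6146 := fun i => by
    simpa using (integral_fisherScore_sq (hlam0 i) le_rfl (Real.sqrt_nonneg _)).2
  have hsqd : ∀ i, ∫ x, fisherScore (lam i) x ^ 2 ∂poissonLaw (lam i + d i) ≤ 6146 := fun i =>
    (integral_fisherScore_sq (hlam0 i) (hd0 i) (hds i)).2
  have hsep : 2 * (1 / 45 * S) ≤ ∑ i, (∫ x, fisherScore (lam i) x ∂oneSidedMixture ε (lam i) (d i) -
      ∫ x, fisherScore (lam i) x ∂poissonLaw (lam i)) := by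
    rw [hSdef, Finset.mul_sum, Finset.mul_sum, Finset.mul_sum]
    refine Finset.sum_le_sum fun i _ => ?_
    rw [integral_oneSidedMixture h0 h1 ((hm0 i).integrable (by norm_num))
      ((hmd i).integrable (by norm_num)), hdmin]
    have := mul_le_mul_of_nonneg_left
      (integral_fisherScore_sub_ge (hlam i) (hd0 i) (hds i)) h0
    linarith
  refine ⟨(∑ i, ∫ y, fisherScore (lam i) y ∂poissonLaw (lam i)) + 1 / 45 * S, ?_⟩
  have hmain := testRisk_pi_le (fun i => poissonLaw (lam i))
    (fun i => oneSidedMixture ε (lam i) (d i)) (fun i => fisherScore (lam i)) hm0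
    (fun i => (memLp_two_iff_integrable_sq .of_discrete).2
      (integrable_oneSidedMixture (hm0 i).integrable_sq (hmd i).integrable_sq)) hsq0
    (fun i => by
      rw [integral_oneSidedMixture h0 h1 (hm0 i).integrable_sq (hmd i).integrable_sq]
      have a := mul_le_mul_of_nonneg_left (hsq0 i) (sub_nonneg.2 h1)
      have b := mul_le_mul_of_nonneg_left (hsqd i) h0
      linarith) (by positivity) hsep
  rw [Fintype.card_fin] at hmain
  refine le_trans ?_ hmain
  simp only [fisherStat_eq_sum]
  -- The null law does not involve the shifts, so only the type II error has to be compared with the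
  -- truncated model.
  exact add_le_add le_rfl (altLaw_sum_lt_le h0 h1 (fun i => (hlam0 i).le) hd0
    (fun i => min_le_left _ _) (fun i => fisherScore_monotone (hlam0 i)) _)

theorem fisherAsymptoticallyPowerful_of_tendsto {lam : ∀ n : ℕ, Fin n → ℝ}
    (hlam : ∀ n i, 1 ≤ lam n i) {ε : ℕ → ℝ} {Δ : ∀ n : ℕ, Fin n → ℝ}
    (hε : ∀ n, 0 ≤ ε n ∧ ε n ≤ 1) (hΔ : ∀ n i, 0 ≤ Δ n i)
    (h : Tendsto (fun n : ℕ =>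
      (ε n * ∑ i, min (Δ n i / Real.sqrt (lam n i)) 1) / Real.sqrt (n : ℝ)) atTop atTop) :
    FisherAsymptoticallyPowerful ε lam Δ := by
  set S : ℕ → ℝ := fun n => ε n * ∑ i, min (Δ n i / Real.sqrt (lam n i)) 1 with hS
  -- For the `n` with `S n` not positive, such as `n = 0`, the threshold is a dummy `0`; eventually
  -- no such `n` remains.
  have hex : ∀ n, ∃ t : ℝ, 0 < S n →
      testRisk (nullLaw (lam n)) (altLaw (ε n) (lam n) (Δ n)) {x | t ≤ fisherStat (lam n) x} ≤
        2 * ENNReal.ofReal (n * 6146 / (1 / 45 * S n) ^ 2) := fun n => by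
    by_cases hn : 0 < S n
    · obtain ⟨t, ht⟩ := exists_testRisk_fisherStat_le (hε n).1 (hε n).2 (hlam n) (hΔ n) hn
      exact ⟨t, fun _ => ht⟩
    · exact ⟨0, fun h => absurd h hn⟩
  choose t ht using hex
  have hlim : Tendsto (fun n : ℕ => 2 * ENNReal.ofReal
      (6146 * 45 ^ 2 * ((S n / Real.sqrt n) ^ 2)⁻¹)) atTop (𝓝 0) := by
    have h1 : Tendsto (fun n : ℕ => 6146 * 45 ^ 2 * ((S n / Real.sqrt n) ^ 2)⁻¹) atTop (𝓝 0) := by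
      simpa using (tendsto_inv_atTop_zero.comp
        ((tendsto_pow_atTop two_ne_zero).comp h)).const_mul (6146 * 45 ^ 2 : ℝ)
    simpa using ENNReal.Tendsto.const_mul (ENNReal.tendsto_ofReal h1) (.inr ENNReal.ofNat_ne_top)
  refine ⟨t, tendsto_of_tendsto_of_tendsto_of_le_of_le' tendsto_const_nhds hlim
    (.of_forall fun _ => zero_le) ?_⟩
  filter_upwards [h.eventually_gt_atTop 0] with n hn
  have hpos : 0 < S n := by
    by_contra hle
    exact absurd hn (not_lt.2 (div_nonpos_of_nonpos_of_nonneg (not_lt.1 hle) (Real.sqrt_nonneg _)))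
  refine (ht n hpos).trans (le_of_eq ?_)
  congr 2
  rw [div_pow, Real.sq_sqrt n.cast_nonneg]
  field_simp

theorem mainTheorem9 (lam : ∀ n : ℕ, Fin n → ℝ) (hlam : ∀ n i, 1 ≤ lam n i) :
    (∀ (ε : ℕ → ℝ) (Δ : ∀ n : ℕ, Fin n → ℝ),
      (∀ n, 0 ≤ ε n ∧ ε n ≤ 1) →
      (∀ n i, 0 < Δ n i) →
      Tendsto (fun n : ℕ => (ε n * ∑ i, min (Δ n i / Real.sqrt (lam n i)) 1) / Real.sqrt (n : ℝ))
        atTop atTop →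
      FisherAsymptoticallyPowerful ε lam Δ) ∧
    (∀ β s : ℝ, 0 < β → β < 1 / 2 → β - 1 / 2 < s →
      FisherAsymptoticallyPowerful (fun n : ℕ => (n : ℝ) ^ (-β)) lam
        (fun n i => (n : ℝ) ^ s * Real.sqrt (lam n i))) := by
  refine ⟨fun ε Δ hε hΔ h =>
    fisherAsymptoticallyPowerful_of_tendsto hlam hε (fun n i => (hΔ n i).le) h,
    fun β s hβ hβ' hs => fisherAsymptoticallyPowerful_of_tendsto hlam (fun n => ⟨by positivity, ?_⟩)
      (fun n i => by positivity) ?_⟩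
  -- At `n = 0` the mixing weight `0 ^ (-β)` is `0`.
  · rcases Nat.eq_zero_or_pos n with rfl | hn
    · simp [Real.zero_rpow (neg_ne_zero.2 hβ.ne')]
    · exact Real.rpow_le_one_of_one_le_of_nonpos (by exact_mod_cast hn) (by linarith)
  -- For `n ≥ 1` the ratio in the criterion equals `n` to this power. The case `s ≥ 0` uses `β <
  -- 1/2`, the other `s > β - 1/2`.
  · have hexp : 0 < min s 0 - β + 1 / 2 := by
      rcases min_choice s 0 with h | h <;> rw [h] <;> linarith
    refine ((tendsto_rpow_atTop hexp).comp tendsto_natCast_atTop_atTop).congr' ?_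
    filter_upwards [eventually_ge_atTop 1] with n hn
    have hn1 : (1 : ℝ) ≤ n := by exact_mod_cast hn
    have hn0 : (0 : ℝ) < n := by linarith
    have hmin : ∀ i, min ((n : ℝ) ^ s * Real.sqrt (lam n i) / Real.sqrt (lam n i)) 1 =
        (n : ℝ) ^ (min s 0) := fun i => by
      have : 0 < Real.sqrt (lam n i) := Real.sqrt_pos.2 (by linarith [hlam n i])
      rw [mul_div_cancel_right₀ _ this.ne',
        (Real.monotone_rpow_of_base_ge_one hn1).map_min, Real.rpow_zero]
    simp only [hmin, Finset.sum_const, Finset.card_univ, Fintype.card_fin, nsmul_eq_mul,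
      Function.comp_apply]
    rw [Real.sqrt_eq_rpow, eq_div_iff (by positivity), ← Real.rpow_add hn0]
    nth_rewrite 3 [← Real.rpow_one (n : ℝ)]
    rw [← Real.rpow_add hn0, ← Real.rpow_add hn0]
    congr 1
    ring
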